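/- For a finite simple graph $G$, let $s^+(G)$ (resp. $s^-(G)$) be the sum of the squares of the positive (resp. negative) eigenvalues of its adjacency matrix, counted with multiplicity; $s^+(G)-s^-(G)$ is the squared spread of $G$. For $t\ge 1$, the $t$-blowup $G^{[t]}$ is the graph obtained by replacing each vertex of $G$ with $t$ independent vertices and each edge with a complete bipartite graph $K_{t,t}$. For an odd prime power $q$, let $T_q$ be Taylor's graph: its vertices are the pairs $(x,y)\in\mathbb F_{q^2}^2$ with $y+y^q+x^{q+1}=0$; with $h\big((x,y),(x',y')\big)=y+x x'^{\,q}+y'^{\,q}$, two distinct vertices $u,v$ are adjacent if and only if $h(u,v)$ is a square in $\mathbb F_{q^2}$ when $q\equiv 3 \pmod 4$, and if and only if $h(u,v)$ is a nonsquare when $q\equiv 1\pmod 4$. **Theorem.** 1. For every $\varepsilon>0$ there is $c>0$ such that for arbitrarily large $n$ there is a graph $G$ on $n$ vertices with $s^+(G)-s^-(G)\le -c\,n^{2-\varepsilon}$; that is, $s^+-s^-=-\Omega(n^{2-\varepsilon})$ along an infinite family. 2. Blowups of Taylor's graphs are such families: for every $\varepsilon>0$ there are an integer $a>0$ and $c>0$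 such that, for all odd prime powers $q$, the graph $T_q^{[q^a]}$ has $n=q^{3+a}$ vertices and squared spread at most $-c\,n^{2-\varepsilon}$. 3. For every odd prime power $q$, the graph $T_q$ is strongly regular on $q^3$ vertices, of degree $k=\frac12(q-1)(q^2+1)$. Its eigenvalues are $k$ with multiplicity $1$, $\frac12(q-1)$ with multiplicity $(q-1)(q^2+1)$, and $-\frac12(q^2+1)$ with multiplicity $q(q-1)$. Its squared spread is $-\frac{q^4}{2}+\frac{q^3}{2}-\frac{q^2}{2}+\frac q2$. 4. The squared spread of $T_q$ is $-\Theta(n^{4/3})$, where $n=q^3$ and $q$ ranges over the odd prime powers. 5. For every fixed integer $a>0$, the squared spread of $T_q^{[q^a]}$ is $-\Theta(n^{2-2/(3+a)})$, where $n=q^{3+a}$ and $q$ ranges over the odd prime powers. 6. For every finite graph $G$ and every integer $t\ge 1$, the eigenvalues of $G^{[t]}$ (with multiplicity) are $t\lambda$, for $\lambda$ running over the eigenvalues of $G$, together with $(t-1)|V(G)|$ additional zeros. -/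

import Mathlib

namespace SquareEnergy

open Classical in
/-- The spectrum of a finite graph: the multiset of eigenvalues of its adjacency matrix, each
repeated according to its multiplicity. (The matrix is real symmetric, so all `|V|` roots of its
characteristic polynomial are real.) -/
noncomputable def spec {V : Type*} [Fintype V] (G : SimpleGraph V) : Multiset ℝ :=
  (G.adjMatrix ℝ).charpoly.roots

open Classical in
/-- The positive square energy `s⁺`: the sum of the squares of the positive eigenvalues. -/
noncomputable def posEnergy {V : Type*} [Fintype V] (G : SimpleGraph V) : ℝ :=
  (((spec G).filter (fun x => 0 < x)).map (fun x => x ^ 2)).sum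

open Classical in
/-- The negative square energy `s⁻`: the sum of the squares of the negative eigenvalues. -/
noncomputable def negEnergy {V : Type*} [Fintype V] (G : SimpleGraph V) : ℝ :=
  (((spec G).filter (fun x => x < 0)).map (fun x => x ^ 2)).sum

/-- The squared spread `s⁺ - s⁻`. -/
noncomputable def sqSpread {V : Type*} [Fintype V] (G : SimpleGraph V) : ℝ :=
  posEnergy G - negEnergy G

/-- The `t`-blowup: each vertex becomes `t` independent vertices, each edge a `K_{t,t}`. -/
def blowup {V : Type*} (G : SimpleGraph V) (t : ℕ) : SimpleGraph (V × Fin t) where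
  Adj x y := G.Adj x.1 y.1
  symm := ⟨fun _ _ h => h.symm⟩
  loopless := ⟨fun x h => G.loopless.irrefl x.1 h⟩

/-- Let `K` be the field with `q²` elements, with involution `x ↦ x ^ q`, and consider the
Hermitian form `h(u, v) = u₁ v₃^q + u₂ v₂^q + u₃ v₁^q` on `K³`. Its isotropic points in the
projective plane are `∞ = (1 : 0 : 0)` and the points `(y : x : 1)` with
`y + y ^ q + x ^ (q + 1) = 0`. This is the set of the latter points, recorded as pairs `(x, y)`. -/
def UnitalPoint (K : Type*) [Field K] (q : ℕ) : Type _ :=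
  {P : K × K // P.2 + P.2 ^ q + P.1 ^ (q + 1) = 0}

noncomputable instance {K : Type*} [Field K] [Fintype K] (q : ℕ) : Fintype (UnitalPoint K q) := by
  classical exact inferInstanceAs (Fintype {P : K × K // P.2 + P.2 ^ q + P.1 ^ (q + 1) = 0})

/-- The Hermitian form at the vectors `(y, x, 1)` and `(y', x', 1)`. -/
def hform {K : Type*} [Field K] {q : ℕ} (u v : UnitalPoint K q) : K :=
  u.1.2 + u.1.1 * v.1.1 ^ q + v.1.2 ^ q

/-- Taylor's graph `T_q`, for `K` the field with `q²` elements and `q` odd. It is the graph on the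
isotropic points other than `∞` obtained from Taylor's unitary two-graph by isolating the point
`∞` and deleting it. A triple of isotropic points `u, v, w` belongs to the two-graph when
`h(u, v) h(v, w) h(w, u)` is a square in `K` (if `q ≡ 3 mod 4`), respectively a nonsquare
(if `q ≡ 1 mod 4`); as `h(∞, v) = 1`, the triple of `∞`, `u`, `v` does so according to `h(u, v)`.
The relation is symmetric on distinct points, see `taylorGraph_adj`. -/
def taylorGraph (K : Type*) [Field K] (q : ℕ) : SimpleGraph (UnitalPoint K q) :=
  SimpleGraph.fromRel (fun u v => IsSquare (hform u v) ↔ q % 4 = 3)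

theorem hform_swap {K : Type*} [Field K] [Fintype K] {q : ℕ} (hK : Fintype.card K = q ^ 2)
    (u v : UnitalPoint K q) : hform v u = hform u v ^ q := by
  obtain ⟨p, hp⟩ := CharP.exists K
  have := hp
  obtain ⟨n, hpr, hn⟩ := FiniteField.card K p
  have : Fact p.Prime := ⟨hpr⟩
  obtain ⟨r, -, hr⟩ := (Nat.dvd_prime_pow hpr).1 (show q ∣ p ^ (n : ℕ) by
    rw [← hn, hK]; exact dvd_pow_self q two_ne_zero)
  have hqq : ∀ x : K, (x ^ q) ^ q = x := fun x => by
    rw [← pow_mul, ← sq, ← hK, FiniteField.pow_card]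
  have hadd : ∀ x y : K, (x + y) ^ q = x ^ q + y ^ q := fun x y => by
    rw [hr]; exact add_pow_char_pow x y p r
  unfold hform
  rw [hadd, hadd, mul_pow, hqq, hqq]
  ring

theorem taylorGraph_adj {K : Type*} [Field K] [Fintype K] {q : ℕ} (hK : Fintype.card K = q ^ 2)
    (u v : UnitalPoint K q) :
    (taylorGraph K q).Adj u v ↔ u ≠ v ∧ (IsSquare (hform u v) ↔ q % 4 = 3) := by
  have h : IsSquare (hform v u) ↔ IsSquare (hform u v) := by
    constructor
    · intro h; rw [hform_swap hK v u]; exact h.pow q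
    · intro h; rw [hform_swap hK u v]; exact h.pow q
  simp [taylorGraph, SimpleGraph.fromRel_adj, h]

end SquareEnergy

/-! Write `χ` for the quadratic character of `K`, `s` for `taylorSign q`, `A` for the adjacency
matrix of `T_q`, and `J` for the all-ones matrix. Then `2A + I` has entries `1 + s χ(h(u,v))`, so
everything reduces to sums of `χ(h)` over one point and of `χ(h(u,w)) χ(h(w,v))` over `w`.
Heisenberg translations preserve `h` and are transitive, so `u` may be taken to be the origin.
Inversion changes `h` by a factor that absorbs one character, turning the product sum into a single
sum. The single sum is found by counting points over each `y`: only the trace-zero `y` contribute,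
and `χ` equals `s` on the nonzero ones. Hence `A²` is a combination of `A`, `J` and `I`. With
regularity this gives a cubic annihilating `A`, and the traces of `1`, `A`, `A²` fix the
multiplicities (`spec_taylorGraph`). In the squared spread the terms of order `q⁶` and `q⁵` cancel,
leaving `-q⁴/2` to leading order. A `t`-blowup multiplies the spread by `t²` but the order only by
`t`, so taking `t = q^a` pushes the exponent from `4/3` towards `2`. -/

namespace SquareEnergy

/-! ### Eigenvalues of polynomials in a symmetric matrix. -/

section LinearAlgebra

open Matrix Polynomial

theorem _root_.Matrix.IsHermitian.roots_charpoly_cfc {n : Type*} [Fintype n] [DecidableEq n]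
    {A : Matrix n n ℝ} (hA : A.IsHermitian) (f : ℝ → ℝ) :
    (cfc f A).charpoly.roots = A.charpoly.roots.map f := by
  rw [hA.charpoly_cfc_eq, hA.roots_charpoly_eq_eigenvalues, Polynomial.roots_prod]
  · simp
  · exact Finset.prod_ne_zero_iff.2 fun i _ => X_sub_C_ne_zero _

theorem _root_.Matrix.IsHermitian.roots_charpoly_aeval {n : Type*} [Fintype n] [DecidableEq n]
    {A : Matrix n n ℝ} (hA : A.IsHermitian) (p : ℝ[X]) :
    (aeval A p).charpoly.roots = A.charpoly.roots.map (fun x => p.eval x) := by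
  exact (congrArg (fun M : Matrix n n ℝ => M.charpoly.roots) (cfc_polynomial p A hA)).symm.trans
    (hA.roots_charpoly_cfc _)

theorem _root_.Matrix.IsHermitian.trace_aeval {n : Type*} [Fintype n] [DecidableEq n]
    {A : Matrix n n ℝ} (hA : A.IsHermitian) (p : ℝ[X]) :
    (aeval A p).trace = (A.charpoly.roots.map (fun x => p.eval x)).sum := by
  have h : (aeval A p).IsHermitian := by
    rw [← cfc_polynomial p A hA]; exact cfc_predicate _ A
  rw [trace_eq_sum_roots_charpoly_of_splits h.splits_charpoly, hA.roots_charpoly_aeval]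

theorem _root_.Multiset.eq_replicate_add_three {α : Type*} [DecidableEq α] {m : Multiset α}
    {a b c : α} (hab : a ≠ b) (hac : a ≠ c) (hbc : b ≠ c)
    (h : ∀ x ∈ m, x = a ∨ x = b ∨ x = c) :
    m = Multiset.replicate (m.count a) a + Multiset.replicate (m.count b) b +
      Multiset.replicate (m.count c) c := by
  ext x
  simp only [Multiset.count_add, Multiset.count_replicate]
  by_cases hx : x ∈ m
  · rcases h x hx with rfl | rfl | rfl <;> simp [*, Ne.symm]
  · have h0 := Multiset.count_eq_zero_of_notMem hx
    rw [h0]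
    split_ifs with h1 h2 h3 h3 h3 <;> simp_all

end LinearAlgebra

/-! ### Spectra of blowups and of graphs satisfying a cubic. -/

section Spectrum

open Matrix Polynomial
open Classical in
theorem spec_eq_of_iso {V W : Type*} [Fintype V] [Fintype W] {G : SimpleGraph V}
    {H : SimpleGraph W} (e : G ≃g H) : spec G = spec H := by
  unfold spec
  rw [← charpoly_reindex e.toEquiv (G.adjMatrix ℝ)]
  congr 2
  ext i j
  simp only [reindex_apply, submatrix_apply, SimpleGraph.adjMatrix_apply]
  congr 1
  have := e.symm.map_adj_iff (v := i) (w := j)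
  exact propext this

theorem sqSpread_eq_of_spec_eq {V W : Type*} [Fintype V] [Fintype W] {G : SimpleGraph V}
    {H : SimpleGraph W} (h : spec G = spec H) : sqSpread G = sqSpread H := by
  unfold sqSpread posEnergy negEnergy
  rw [h]

/-- The function `x * |x|` handles both signs at once, ignores zeros, and is homogeneous of degree 2
under positive scaling, which is what blowups require. -/
theorem sqSpread_eq_sum {V : Type*} [Fintype V] (G : SimpleGraph V) :
    sqSpread G = ((spec G).map (fun x => x * |x|)).sum := by
  unfold sqSpread posEnergy negEnergy
  induction spec G using Multiset.induction with
  | empty => simp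
  | cons a s ih =>
    rw [Multiset.map_cons, Multiset.sum_cons, ← ih]
    rcases lt_trichotomy a 0 with h | rfl | h
    · simp [h, h.not_gt, abs_of_neg h]; ring
    · simp
    · simp [h, h.not_gt, abs_of_pos h]; ring

theorem spec_eq_roots {V : Type*} [Fintype V] [DecidableEq V] (G : SimpleGraph V)
    [DecidableRel G.Adj] : spec G = (G.adjMatrix ℝ).charpoly.roots := by
  unfold spec
  convert rfl

open Classical in
-- The blown-up matrix factors through `V` as `P * Q` with `Q * P = t A`; the characteristic
-- polynomials of `P * Q` and `Q * P` differ only by a power of `X`.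
theorem spec_blowup {V : Type*} [Fintype V] (G : SimpleGraph V) {t : ℕ} (ht : 0 < t) :
    spec (blowup G t) = (spec G).map (fun x => (t : ℝ) * x) +
      Multiset.replicate ((t - 1) * Fintype.card V) 0 := by
  have hA : (G.adjMatrix ℝ).IsHermitian := SimpleGraph.isHermitian_adjMatrix ℝ G
  have hle : Fintype.card V ≤ Fintype.card (V × Fin t) := by
    rw [Fintype.card_prod, Fintype.card_fin]; exact Nat.le_mul_of_pos_right _ ht
  let P : Matrix (V × Fin t) V ℝ := (1 : Matrix V V ℝ).submatrix Prod.fst id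
  let Q : Matrix V (V × Fin t) ℝ := (G.adjMatrix ℝ).submatrix id Prod.fst
  have h1 : (blowup G t).adjMatrix ℝ = P * Q := by
    rw [← submatrix_mul _ _ _ _ _ Function.bijective_id, one_mul]
    ext x y
    simp only [SimpleGraph.adjMatrix_apply, submatrix_apply, blowup]
    congr
  have h2 : Q * P = aeval (G.adjMatrix ℝ) (C (t : ℝ) * X) := by
    rw [map_mul, aeval_C, aeval_X, ← Algebra.smul_def]
    ext v w
    rw [Matrix.mul_apply, Fintype.sum_prod_type, Matrix.smul_apply]
    simp [P, Q, one_apply]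
  rw [spec_eq_roots (blowup G t), spec_eq_roots G, h1, charpoly_mul_comm_of_le _ _ hle, h2, roots_mul, roots_X_pow, hA.roots_charpoly_aeval,
    add_comm, Fintype.card_prod, Fintype.card_fin, Multiset.nsmul_singleton,
    tsub_mul, one_mul, mul_comm t]
  · simp
  · exact mul_ne_zero (pow_ne_zero _ X_ne_zero) (charpoly_monic _).ne_zero

theorem sqSpread_blowup {V : Type*} [Fintype V] (G : SimpleGraph V) {t : ℕ} (ht : 0 < t) :
    sqSpread (blowup G t) = (t : ℝ) ^ 2 * sqSpread G := by
  rw [sqSpread_eq_sum, sqSpread_eq_sum, spec_blowup G ht, ← Multiset.sum_map_mul_left]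
  simp only [Multiset.map_add, Multiset.map_map, Multiset.sum_add, Multiset.map_replicate,
    Multiset.sum_replicate, Function.comp_apply]
  simp only [zero_mul, smul_zero, add_zero, abs_mul, Nat.abs_cast]
  congr 1
  exact Multiset.map_congr rfl fun x _ => by ring

open Classical in
/-- A graph whose adjacency matrix is annihilated by a cubic with distinct real roots: its spectrum
consists of these roots, with multiplicities constrained by the traces of the powers. -/
theorem exists_spec_eq_of_cubic {V : Type*} [Fintype V] (G : SimpleGraph V) {k : ℕ} {a b c : ℝ}
    (hab : a ≠ b) (hac : a ≠ c) (hbc : b ≠ c) (hk : G.IsRegularOfDegree k)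
    (h : (G.adjMatrix ℝ - algebraMap ℝ _ a) * ((G.adjMatrix ℝ - algebraMap ℝ _ b) *
      (G.adjMatrix ℝ - algebraMap ℝ _ c)) = 0) :
    ∃ x y z : ℕ, spec G = Multiset.replicate x a + Multiset.replicate y b +
        Multiset.replicate z c ∧
      (x + y + z : ℝ) = Fintype.card V ∧ x * a + y * b + z * c = 0 ∧
      x * a ^ 2 + y * b ^ 2 + z * c ^ 2 = Fintype.card V * k := by
  have hA : (G.adjMatrix ℝ).IsHermitian := SimpleGraph.isHermitian_adjMatrix ℝ G
  have hroots : ∀ x ∈ spec G, x = a ∨ x = b ∨ x = c := by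
    intro x hx
    -- The cubic sends the spectrum of `A` to that of the zero matrix, so every eigenvalue is a root
    -- of it.
    have h1 := hA.roots_charpoly_aeval ((X - C a) * ((X - C b) * (X - C c)))
    simp only [map_mul, map_sub, aeval_X, aeval_C] at h1
    rw [h] at h1
    simp only [charpoly_zero, roots_X_pow] at h1
    have h2 := Multiset.mem_map_of_mem
      (fun x => eval x ((X - C a) * ((X - C b) * (X - C c)))) hx
    rw [spec, ← h1, Multiset.nsmul_singleton] at h2
    have h3 := Multiset.eq_of_mem_replicate h2
    simpa [sub_eq_zero] using h3
  have hs := Multiset.eq_replicate_add_three hab hac hbc hroots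
  refine ⟨_, _, _, hs, ?_⟩
  have t0 := hA.trace_aeval 1
  have t1 := hA.trace_aeval X
  have t2 := hA.trace_aeval (X ^ 2)
  change _ = (Multiset.map _ (spec G)).sum at t0 t1 t2
  rw [hs] at t0 t1 t2
  have hsq : (G.adjMatrix ℝ ^ 2).trace = Fintype.card V * k := by
    rw [sq, trace]
    simp only [diag_apply, SimpleGraph.adjMatrix_mul_self_apply_self, hk.degree_eq]
    simp
  simp only [map_pow, aeval_X, hsq, map_one, SimpleGraph.trace_adjMatrix] at t0 t1 t2
  simp at t0 t1 t2
  exact ⟨t0.symm, t1.symm, t2.symm⟩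

end Spectrum

/-! ### Norms, traces and the quadratic character of the field with `q²` elements. -/

section FiniteField

variable {K : Type*} [Field K] [Fintype K] {q : ℕ}

theorem pow_pow_of_card (hK : Fintype.card K = q ^ 2) (x : K) : (x ^ q) ^ q = x := by
  rw [← pow_mul, ← sq, ← hK, FiniteField.pow_card]

theorem add_pow_of_card (hK : Fintype.card K = q ^ 2) (x y : K) :
    (x + y) ^ q = x ^ q + y ^ q := by
  obtain ⟨p, hp⟩ := CharP.exists K
  have := hp
  obtain ⟨n, hpr, hn⟩ := FiniteField.card K p
  have : Fact p.Prime := ⟨hpr⟩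
  obtain ⟨r, -, rfl⟩ := (Nat.dvd_prime_pow hpr).1 (show q ∣ p ^ (n : ℕ) by
    rw [← hn, hK]; exact dvd_pow_self q two_ne_zero)
  exact add_pow_char_pow x y p r

theorem one_lt_of_card (hK : Fintype.card K = q ^ 2) : 1 < q := by
  have := Fintype.one_lt_card (α := K)
  rw [hK] at this
  by_contra! h
  interval_cases q <;> simp at this

theorem three_le_of_card (hK : Fintype.card K = q ^ 2) (hq : Odd q) : 3 ≤ q := by
  have := one_lt_of_card hK
  obtain ⟨m, rfl⟩ := hq
  omega

theorem card_eq_sub_one_mul_add_one (hK : Fintype.card K = q ^ 2) :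
    Fintype.card K = (q - 1) * (q + 1) + 1 := by
  obtain ⟨m, rfl⟩ := Nat.exists_eq_add_of_lt (one_lt_of_card hK)
  rw [hK, show 1 + m + 1 - 1 = 1 + m by omega]
  ring

theorem ringChar_ne_two_of_card (hK : Fintype.card K = q ^ 2) (hq : Odd q) : ringChar K ≠ 2 := by
  rw [Ne, FiniteField.even_card_iff_char_two, hK]
  have := Nat.odd_iff.1 (hq.pow (n := 2))
  omega

open Classical in
-- `Kˣ` is cyclic of order `d * e`, so `c ^ e = 1` makes `c` a `d`-th power, and its `d`-th roots
-- form a coset of the group of `d`-th roots of unity.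
theorem card_pow_eq {d e : ℕ} (hde : Fintype.card K = d * e + 1) {c : K} (hc : c ≠ 0)
    (hce : c ^ e = 1) : (Finset.univ.filter fun x : K => x ^ d = c).card = d := by
  have hcard : Fintype.card Kˣ = d * e := by rw [Fintype.card_units, hde]; rfl
  have hpos : 0 < d * e := hcard ▸ Fintype.card_pos
  have hd : 0 < d := Nat.pos_of_mul_pos_right hpos
  have he : 0 < e := Nat.pos_of_mul_pos_left hpos
  obtain ⟨g, hg⟩ := IsCyclic.exists_ofOrder_eq_natCard (α := Kˣ)
  rw [Nat.card_eq_fintype_card, hcard] at hg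
  have hgp : IsPrimitiveRoot (g : K) (d * e) := by
    rw [← hg]; exact IsPrimitiveRoot.coe_units_iff.2 (IsPrimitiveRoot.orderOf g)
  have hgd : IsPrimitiveRoot ((g : K) ^ e) d := hgp.pow hpos (mul_comm d e)
  have hge : IsPrimitiveRoot ((g : K) ^ d) e := hgp.pow hpos rfl
  have : NeZero e := ⟨he.ne'⟩
  obtain ⟨i, -, hi⟩ := hge.eq_pow_of_pow_eq_one hce
  have h1 := hgd.card_nthRoots c
  rw [if_pos ⟨(g : K) ^ i, by rw [← hi, ← pow_mul, ← pow_mul, mul_comm]⟩] at h1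
  have h2 : (Finset.univ.filter fun x : K => x ^ d = c) = (Polynomial.nthRoots d c).toFinset := by
    ext x; simp [Polynomial.mem_nthRoots hd]
  rw [h2, Multiset.toFinset_card_of_nodup (hgd.nthRoots_nodup hc), h1]

open Classical in
-- Since `y + y^q = y (y^(q-1) + 1)`, the nonzero solutions are the `(q-1)`-th roots of `-1`.
theorem card_trace_eq_zero (hK : Fintype.card K = q ^ 2) (hq : Odd q) :
    (Finset.univ.filter fun y : K => y + y ^ q = 0).card = q := by
  have h1 := one_lt_of_card hK
  have h2 := card_pow_eq (K := K) (d := q - 1) (e := q + 1) (c := -1)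
    (card_eq_sub_one_mul_add_one hK) (by simp) hq.add_one.neg_one_pow
  have h3 : (Finset.univ.filter fun y : K => y + y ^ q = 0) =
      insert 0 (Finset.univ.filter fun x : K => x ^ (q - 1) = -1) := by
    ext y
    simp only [Finset.mem_filter, Finset.mem_univ, true_and, Finset.mem_insert]
    have h4 : y + y ^ q = y * (y ^ (q - 1) + 1) := by
      rw [mul_add, ← pow_succ', Nat.sub_add_cancel h1.le]; ring
    rw [h4, mul_eq_zero, eq_neg_iff_add_eq_zero]
  rw [h3, Finset.card_insert_of_notMem, h2]
  · omega
  · simp [zero_pow (show q - 1 ≠ 0 by omega)]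

open Classical in
theorem card_norm_eq_neg_trace (hK : Fintype.card K = q ^ 2) (hq : Odd q) (y : K) :
    (Finset.univ.filter fun x : K => y + y ^ q + x ^ (q + 1) = 0).card =
      if y + y ^ q = 0 then 1 else q + 1 := by
  have h1 := one_lt_of_card hK
  split_ifs with h
  · rw [h, Finset.card_eq_one]
    exact ⟨0, by ext x; simp⟩
  · have hc : -(y + y ^ q) ≠ 0 := neg_ne_zero.2 h
    have h2 := card_pow_eq (K := K) (d := q + 1) (e := q - 1) (c := -(y + y ^ q))
      (by rw [mul_comm]; exact card_eq_sub_one_mul_add_one hK) hc (by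
        -- The trace is fixed by `x ↦ x^q`, hence so is its negative `c`; cancelling `c` from `c^q =
        -- c` gives `c^(q-1) = 1`.
        apply mul_left_cancel₀ hc
        rw [← pow_succ', Nat.sub_add_cancel h1.le, hq.neg_pow, add_pow_of_card hK,
          pow_pow_of_card hK]
        ring)
    refine Eq.trans (congrArg Finset.card ?_) h2
    ext x
    simp only [Finset.mem_filter, Finset.mem_univ, true_and]
    rw [add_comm, add_eq_zero_iff_eq_neg]

/-- The fibre over `y` has `q + 1` points, except for a single point when `y` has trace zero; the
second sum corrects for this. -/
theorem sum_unitalPoint (hK : Fintype.card K = q ^ 2) (hq : Odd q) [DecidableEq K] (g : K → ℤ) :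
    ∑ p : UnitalPoint K q, g p.1.2 =
      (q + 1) * ∑ y, g y - q * ∑ y with y + y ^ q = 0, g y := by
  classical
  have h1 : ∑ p : UnitalPoint K q, g p.1.2 =
      ∑ P : K × K with P.2 + P.2 ^ q + P.1 ^ (q + 1) = 0, g P.2 := by
    refine (Finset.sum_subtype _ (fun x => ?_) fun P : K × K => g P.2).symm
    simp
  rw [h1, Finset.sum_filter, Fintype.sum_prod_type_right, Finset.mul_sum, Finset.sum_filter,
    Finset.mul_sum, ← Finset.sum_sub_distrib]
  refine Finset.sum_congr rfl fun y _ => ?_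
  have h2 := card_norm_eq_neg_trace hK hq y
  dsimp only
  rw [← Finset.sum_filter, Finset.sum_const, nsmul_eq_mul]
  have h3 : (Finset.univ.filter fun x : K => y + y ^ q + x ^ (q + 1) = 0).card =
      if y + y ^ q = 0 then 1 else q + 1 := by convert h2
  rw [h3]
  split_ifs <;> push_cast <;> ring

theorem card_unitalPoint (hK : Fintype.card K = q ^ 2) (hq : Odd q) :
    Fintype.card (UnitalPoint K q) = q ^ 3 := by
  classical
  have h := sum_unitalPoint hK hq (fun _ => 1)
  have h2 := card_trace_eq_zero hK hq
  simp only [Finset.sum_const, nsmul_eq_mul, mul_one, Finset.card_univ, hK] at h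
  rw [show (Finset.univ.filter fun y : K => y + y ^ q = 0).card = q by convert h2] at h
  zify
  rw [h]; push_cast; ring

/-- The value of the quadratic character at the nonzero elements of trace zero. -/
def taylorSign (q : ℕ) : ℤ := if q % 4 = 3 then 1 else -1

/-- Here `y^(q-1) = -1`, so Euler's criterion evaluates `y^((q²-1)/2) = (-1)^((q+1)/2)`. This is the
source of the split modulo 4 in the definition of `T_q`. -/
theorem quadraticChar_of_trace_eq_zero [DecidableEq K] (hK : Fintype.card K = q ^ 2) (hq : Odd q)
    {y : K} (hy : y ≠ 0) (h : y + y ^ q = 0) : quadraticChar K y = taylorSign q := by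
  have hchar := ringChar_ne_two_of_card hK hq
  have h1 := one_lt_of_card hK
  have h4 : y ^ (q - 1) = -1 := by
    have : y * (y ^ (q - 1) + 1) = 0 := by
      rw [mul_add, ← pow_succ', Nat.sub_add_cancel h1.le, ← h]; ring
    exact eq_neg_of_add_eq_zero_left ((mul_eq_zero.1 this).resolve_left hy)
  obtain ⟨m, hm⟩ := hq
  have h5 : y ^ (Fintype.card K / 2) = (-1) ^ (m + 1) := by
    rw [← h4, ← pow_mul]
    congr 1
    rw [card_eq_sub_one_mul_add_one hK, hm, show 2 * m + 1 - 1 = 2 * m by omega,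
      show 2 * m * (2 * m + 1 + 1) + 1 = 2 * (2 * m * (m + 1)) + 1 by ring]
    omega
  unfold taylorSign
  split_ifs with h3
  · rw [quadraticChar_one_iff_isSquare hy, FiniteField.isSquare_iff hchar hy, h5]
    exact Even.neg_one_pow (by rw [Nat.even_iff]; omega)
  · rw [quadraticChar_neg_one_iff_not_isSquare, FiniteField.isSquare_iff hchar hy, h5,
      Odd.neg_one_pow (by rw [Nat.odd_iff]; omega)]
    exact Ring.neg_one_ne_one_of_char_ne_two hchar

theorem quadraticChar_pow_odd [DecidableEq K] (hq : Odd q) (x : K) :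
    quadraticChar K (x ^ q) = quadraticChar K x := by
  rw [map_pow]
  rcases quadraticChar_isQuadratic K x with h | h | h
  · rw [h, zero_pow hq.pos.ne']
  · rw [h, one_pow]
  · rw [h, hq.neg_one_pow]

theorem sum_quadraticChar_snd [DecidableEq K] (hK : Fintype.card K = q ^ 2) (hq : Odd q) :
    ∑ p : UnitalPoint K q, quadraticChar K p.1.2 = -(taylorSign q * (q ^ 2 - q)) := by
  rw [sum_unitalPoint hK hq (fun y => quadraticChar K y),
    quadraticChar_sum_zero (ringChar_ne_two_of_card hK hq)]
  have h1 : ∀ y ∈ (Finset.univ.filter fun y : K => y + y ^ q = 0), quadraticChar K y =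
      taylorSign q - if y = 0 then taylorSign q else 0 := by
    intro y hy
    split_ifs with h
    · simp [h]
    · rw [quadraticChar_of_trace_eq_zero hK hq h (Finset.mem_filter.1 hy).2, sub_zero]
  have h2 := card_trace_eq_zero hK hq
  rw [Finset.sum_congr rfl h1, Finset.sum_sub_distrib, Finset.sum_ite_eq', Finset.sum_const,
    show (Finset.univ.filter fun y : K => y + y ^ q = 0).card = q by convert h2, if_pos]
  · simp only [nsmul_eq_mul]; ring
  · simp [zero_pow hq.pos.ne']

end FiniteField

/-! ### Symmetries of the unital and the character sums they yield. -/

section Unital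

variable {K : Type*} [Field K] {q : ℕ}

theorem hform_self (u : UnitalPoint K q) : hform u u = 0 := by
  have := u.2
  unfold hform
  linear_combination this

/-- The isotropic point with coordinates `(0, 0)`. -/
def unitalOrigin (hq : Odd q) : UnitalPoint K q :=
  ⟨(0, 0), by simp [zero_pow hq.pos.ne']⟩

/-- The isometry of the Hermitian form that exchanges the origin with the point at infinity. -/
noncomputable def invert (hq : Odd q) (u : UnitalPoint K q) :
    UnitalPoint K q :=
  -- Infinity is not a `UnitalPoint`. Division by zero gives zero, so the origin is fixed instead,
  -- and the map is still an involution.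
  ⟨(u.1.1 / u.1.2, u.1.2⁻¹), by
    by_cases h0 : u.1.2 = 0
    · simp [h0, zero_pow hq.pos.ne']
    have hu := u.2
    dsimp only
    rw [div_pow, inv_pow, pow_succ u.1.2]
    have h1 := pow_ne_zero q h0
    field_simp
    linear_combination hu⟩

theorem hform_invert (hq : Odd q) {u v : UnitalPoint K q}
    (hu : u.1.2 ≠ 0) (hv : v.1.2 ≠ 0) :
    hform (invert hq u) (invert hq v) = hform u v / (u.1.2 * v.1.2 ^ q) := by
  have h1 := pow_ne_zero q hv
  simp only [hform, invert, div_pow, inv_pow]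
  field_simp
  ring

variable [Fintype K]

theorem hform_eq_zero_iff (hK : Fintype.card K = q ^ 2) (hq : Odd q) (u v : UnitalPoint K q) :
    hform u v = 0 ↔ u = v := by
  refine ⟨fun h => ?_, fun h => h ▸ hform_self _⟩
  have h' : hform v u = 0 := by rw [hform_swap hK, h, zero_pow hq.pos.ne']
  obtain ⟨⟨x, y⟩, hu⟩ := u
  obtain ⟨⟨x', y'⟩, hv⟩ := v
  simp only [hform] at h h' hu hv
  -- The norm of `x - x'` is a combination of the two point equations and `h(u,v) + h(v,u)`.
  have hx : (x - x') ^ (q + 1) = 0 := by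
    rw [pow_succ, sub_eq_add_neg, add_pow_of_card hK, hq.neg_pow]
    linear_combination hu + hv - h - h'
  have hx' : x = x' := sub_eq_zero.1 (pow_eq_zero_iff (Nat.succ_ne_zero q) |>.1 hx)
  subst hx'
  have hy : y' = y := by
    rw [← pow_pow_of_card hK y, ← pow_pow_of_card hK y']
    congr 1
    linear_combination h - hu
  subst hy
  rfl

/-- The Heisenberg translation carrying the origin to `u`. -/
def translate (hK : Fintype.card K = q ^ 2) (hq : Odd q) (u v : UnitalPoint K q) :
    UnitalPoint K q :=
  ⟨(v.1.1 + u.1.1, v.1.2 - u.1.1 ^ q * v.1.1 + u.1.2), by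
    have hu := u.2
    have hv := v.2
    dsimp only
    rw [pow_succ] at hu hv ⊢
    rw [add_pow_of_card hK, add_pow_of_card hK, sub_eq_add_neg, add_pow_of_card hK, hq.neg_pow,
      mul_pow, pow_pow_of_card hK]
    linear_combination hu + hv⟩

theorem hform_translate (hK : Fintype.card K = q ^ 2) (hq : Odd q) (u v w : UnitalPoint K q) :
    hform (translate hK hq u v) (translate hK hq u w) = hform v w := by
  have hu := u.2
  simp only [hform, translate]
  rw [pow_succ] at hu
  rw [add_pow_of_card hK, add_pow_of_card hK, sub_eq_add_neg _ (u.1.1 ^ q * w.1.1),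
    add_pow_of_card hK, hq.neg_pow, mul_pow, pow_pow_of_card hK]
  linear_combination hu

theorem translate_origin (hK : Fintype.card K = q ^ 2) (hq : Odd q) (u : UnitalPoint K q) :
    translate hK hq u (unitalOrigin hq) = u := by
  apply Subtype.ext
  simp [translate, unitalOrigin]

theorem translate_bijective (hK : Fintype.card K = q ^ 2) (hq : Odd q) (u : UnitalPoint K q) :
    Function.Bijective (translate hK hq u) := by
  rw [← Finite.injective_iff_bijective]
  intro v w h
  rw [← hform_eq_zero_iff hK hq, ← hform_translate hK hq u, h, hform_self]

theorem snd_ne_zero (hK : Fintype.card K = q ^ 2) (hq : Odd q) {u : UnitalPoint K q}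
    (hu : u ≠ unitalOrigin hq) : u.1.2 ≠ 0 := by
  intro h
  apply hu
  rw [← hform_eq_zero_iff hK hq]
  simp [hform, unitalOrigin, h, zero_pow hq.pos.ne']

theorem invert_invert (hK : Fintype.card K = q ^ 2) (hq : Odd q) (u : UnitalPoint K q) :
    invert hq (invert hq u) = u := by
  by_cases h : u = unitalOrigin hq
  · subst h
    apply Subtype.ext
    simp [invert, unitalOrigin]
  · have h0 := snd_ne_zero hK hq h
    apply Subtype.ext
    simp [invert, h0]

theorem sum_quadraticChar_hform [DecidableEq K] (hK : Fintype.card K = q ^ 2) (hq : Odd q)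
    (u : UnitalPoint K q) :
    ∑ w, quadraticChar K (hform w u) = -(taylorSign q * (q ^ 2 - q)) := by
  rw [← sum_quadraticChar_snd hK hq, ← (translate_bijective hK hq u).sum_comp]
  refine Finset.sum_congr rfl fun w _ => ?_
  nth_rewrite 2 [← translate_origin hK hq u]
  rw [hform_translate]
  simp [hform, unitalOrigin, zero_pow hq.pos.ne']

/-- Inversion multiplies `h(w,v)` by the inverse of `w.2 * v.2^q`, of character `χ(w.2) χ(v.2)`; the
factor `χ(w.2)` cancels and a single character sum remains. -/
theorem sum_quadraticChar_hform_origin_mul [DecidableEq K] (hK : Fintype.card K = q ^ 2)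
    (hq : Odd q) {v : UnitalPoint K q} (hv : v ≠ unitalOrigin hq) :
    ∑ w : UnitalPoint K q, quadraticChar K w.1.2 * quadraticChar K (hform w v) =
      -1 - taylorSign q * (q ^ 2 - q) * quadraticChar K v.1.2 := by
  classical
  have hv0 := snd_ne_zero hK hq hv
  have h1 : ∀ w : UnitalPoint K q, quadraticChar K w.1.2 * quadraticChar K (hform w v) =
      quadraticChar K v.1.2 * (quadraticChar K (hform (invert hq w) (invert hq v)) -
        -- The left side vanishes at the origin, but its inverted term is `χ(v.2)` because `invert`
        -- fixes the origin. Removing it produces the `-1` in the result.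
        if w = unitalOrigin hq then quadraticChar K v.1.2 else 0) := by
    intro w
    have hv2 := quadraticChar_sq_one hv0
    split_ifs with hw
    · subst hw
      have : hform (invert hq (unitalOrigin hq)) (invert hq v) = (v.1.2⁻¹) ^ q := by
        simp [hform, invert, unitalOrigin]
      rw [this, quadraticChar_pow_odd hq]
      have h3 : quadraticChar K v.1.2 * quadraticChar K v.1.2⁻¹ = 1 := by
        rw [← map_mul, mul_inv_cancel₀ hv0, map_one]
      simp only [unitalOrigin, MulChar.map_zero, zero_mul]
      linear_combination -h3 + hv2
    · have hw0 := snd_ne_zero hK hq hw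
      have hw2 := quadraticChar_sq_one hw0
      have h3 : quadraticChar K (hform w v) =
          quadraticChar K (hform (invert hq w) (invert hq v)) *
          (quadraticChar K w.1.2 * quadraticChar K v.1.2) := by
        rw [← quadraticChar_pow_odd hq v.1.2, ← map_mul, ← map_mul, hform_invert hq hw0 hv0,
          div_mul_cancel₀ _ (mul_ne_zero hw0 (pow_ne_zero q hv0))]
      rw [h3, sub_zero]
      linear_combination (quadraticChar K v.1.2 *
        quadraticChar K (hform (invert hq w) (invert hq v))) * hw2
  have hinv : Function.Bijective (invert hq) :=
    Function.Involutive.bijective (invert_invert hK hq)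
  rw [Finset.sum_congr rfl fun w _ => h1 w, ← Finset.mul_sum, Finset.sum_sub_distrib,
    hinv.sum_comp (fun w => quadraticChar K (hform w (invert hq v))),
    sum_quadraticChar_hform hK hq]
  simp only [Finset.sum_ite_eq', Finset.mem_univ, if_true]
  linear_combination -(quadraticChar_sq_one hv0)

theorem quadraticChar_hform_comm [DecidableEq K] (hK : Fintype.card K = q ^ 2) (hq : Odd q)
    (u v : UnitalPoint K q) : quadraticChar K (hform u v) = quadraticChar K (hform v u) := by
  rw [hform_swap hK v u, quadraticChar_pow_odd hq]

theorem sum_quadraticChar_hform_mul_of_ne [DecidableEq K] (hK : Fintype.card K = q ^ 2)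
    (hq : Odd q) {u v : UnitalPoint K q} (huv : u ≠ v) :
    ∑ w, quadraticChar K (hform u w) * quadraticChar K (hform w v) =
      -1 - taylorSign q * (q ^ 2 - q) * quadraticChar K (hform u v) := by
  have hb := translate_bijective hK hq u
  obtain ⟨v, rfl⟩ := hb.2 v
  have hv : v ≠ unitalOrigin hq := by
    rintro rfl; exact huv (translate_origin hK hq u).symm
  have h0 : ∀ w, quadraticChar K (hform u (translate hK hq u w)) = quadraticChar K w.1.2 := by
    intro w
    nth_rewrite 1 [← translate_origin hK hq u]
    rw [hform_translate, ← quadraticChar_pow_odd hq w.1.2]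
    simp [hform, unitalOrigin]
  rw [← hb.sum_comp, h0, ← sum_quadraticChar_hform_origin_mul hK hq hv]
  refine Finset.sum_congr rfl fun w _ => ?_
  rw [h0, hform_translate]

theorem sum_quadraticChar_hform_mul_self [DecidableEq K] (hK : Fintype.card K = q ^ 2)
    (hq : Odd q) (u : UnitalPoint K q) :
    ∑ w, quadraticChar K (hform u w) * quadraticChar K (hform w u) = q ^ 3 - 1 := by
  classical
  have h1 : ∀ w, quadraticChar K (hform u w) * quadraticChar K (hform w u) =
      1 - if w = u then 1 else 0 := by
    intro w
    split_ifs with h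
    · simp [h, hform_self]
    · rw [quadraticChar_hform_comm hK hq u w, ← sq, quadraticChar_sq_one, sub_zero]
      rwa [Ne, hform_eq_zero_iff hK hq]
  rw [Finset.sum_congr rfl fun w _ => h1 w, Finset.sum_sub_distrib]
  simp [card_unitalPoint hK hq]

end Unital

/-! ### Taylor's graph: strong regularity, spectrum, spread and blowups. -/

section Taylor

variable {K : Type*} [Field K] [Fintype K] {q : ℕ}

theorem taylorSign_mul_self (q : ℕ) : taylorSign q * taylorSign q = 1 := by
  unfold taylorSign; split_ifs <;> rfl

open Classical in
theorem two_mul_adj_taylorGraph (hK : Fintype.card K = q ^ 2) (hq : Odd q)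
    (u v : UnitalPoint K q) :
    2 * (if (taylorGraph K q).Adj u v then 1 else 0) =
      1 + taylorSign q * quadraticChar K (hform u v) - if u = v then 1 else 0 := by
  by_cases huv : u = v
  · subst huv; simp [hform_self]
  · have h0 : hform u v ≠ 0 := by rwa [Ne, hform_eq_zero_iff hK hq]
    rw [taylorGraph_adj hK]
    by_cases hs : IsSquare (hform u v)
    · rw [(quadraticChar_one_iff_isSquare h0).2 hs]
      by_cases h3 : q % 4 = 3 <;> simp [huv, hs, h3, taylorSign]
    · rw [quadraticChar_neg_one_iff_not_isSquare.2 hs]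
      by_cases h3 : q % 4 = 3 <;> simp [huv, hs, h3, taylorSign]

theorem sum_one_add_quadraticChar [DecidableEq K] (hK : Fintype.card K = q ^ 2) (hq : Odd q)
    (u : UnitalPoint K q) :
    ∑ w, (1 + taylorSign q * quadraticChar K (hform u w)) = q ^ 3 - q ^ 2 + q := by
  have h1 := sum_quadraticChar_hform hK hq u
  simp only [← quadraticChar_hform_comm hK hq u] at h1
  rw [Finset.sum_add_distrib, ← Finset.mul_sum, h1]
  simp only [Finset.sum_const, Finset.card_univ, card_unitalPoint hK hq, nsmul_eq_mul, mul_one,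
    Nat.cast_pow]
  linear_combination (-(q : ℤ) ^ 2 + q) * taylorSign_mul_self q

theorem sum_one_add_quadraticChar_mul [DecidableEq K] (hK : Fintype.card K = q ^ 2) (hq : Odd q)
    [DecidableEq (UnitalPoint K q)] (u v : UnitalPoint K q) :
    ∑ w, (1 + taylorSign q * quadraticChar K (hform u w)) *
        (1 + taylorSign q * quadraticChar K (hform w v)) =
      (q ^ 3 - q ^ 2 + q - 1) -
        (q ^ 2 - q) * (1 + taylorSign q * quadraticChar K (hform u v)) +
        q ^ 3 * (if u = v then 1 else 0) := by
  have h1 := sum_one_add_quadraticChar hK hq u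
  have h2 := sum_quadraticChar_hform hK hq v
  have h3 : ∑ w, quadraticChar K (hform u w) * quadraticChar K (hform w v) =
      -1 - taylorSign q * (q ^ 2 - q) * quadraticChar K (hform u v) +
        q ^ 3 * (if u = v then 1 else 0) := by
    split_ifs with huv
    · subst huv
      rw [sum_quadraticChar_hform_mul_self hK hq, hform_self]; simp; ring
    · rw [sum_quadraticChar_hform_mul_of_ne hK hq huv]; ring
  have hs := taylorSign_mul_self q
  have h4 : ∀ w, (1 + taylorSign q * quadraticChar K (hform u w)) *
      (1 + taylorSign q * quadraticChar K (hform w v)) =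
      (1 + taylorSign q * quadraticChar K (hform u w)) +
        taylorSign q * quadraticChar K (hform w v) +
        quadraticChar K (hform u w) * quadraticChar K (hform w v) := fun w => by
    linear_combination (quadraticChar K (hform u w) * quadraticChar K (hform w v)) * hs
  rw [Finset.sum_congr rfl fun w _ => h4 w, Finset.sum_add_distrib, Finset.sum_add_distrib,
    ← Finset.mul_sum, h1, h2, h3]
  linear_combination (-(q : ℤ) ^ 2 + q) * hs

open Classical in
theorem two_mul_degree_taylorGraph (hK : Fintype.card K = q ^ 2) (hq : Odd q)
    (u : UnitalPoint K q) :
    2 * ((taylorGraph K q).degree u : ℤ) = (q - 1) * (q ^ 2 + 1) := by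
  have h1 : ((taylorGraph K q).degree u : ℤ) =
      ∑ v, if (taylorGraph K q).Adj u v then 1 else 0 := by
    rw [← SimpleGraph.card_neighborFinset_eq_degree, SimpleGraph.neighborFinset_eq_filter]
    simp
  rw [h1, Finset.mul_sum, Finset.sum_congr rfl fun v _ => two_mul_adj_taylorGraph hK hq u v,
    Finset.sum_sub_distrib, sum_one_add_quadraticChar hK hq]
  simp
  ring

open Classical in
theorem isRegularOfDegree_taylorGraph (hK : Fintype.card K = q ^ 2) (hq : Odd q) :
    (taylorGraph K q).IsRegularOfDegree ((q - 1) * (q ^ 2 + 1) / 2) := by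
  intro u
  have h := two_mul_degree_taylorGraph hK hq u
  have h1 : 2 * (taylorGraph K q).degree u = (q - 1) * (q ^ 2 + 1) := by
    zify [hq.pos]
    exact h
  omega

open Classical in
-- The character sums express the square of `M = 2A + I` through `J`, `M` and `I`; expanding `M²`
-- and dividing by 4 isolates `A²`.
theorem adjMatrix_taylorGraph_mul_self (hK : Fintype.card K = q ^ 2) (hq : Odd q) :
    (taylorGraph K q).adjMatrix ℝ * (taylorGraph K q).adjMatrix ℝ =
      (((q : ℝ) - 1) * (q ^ 2 + 1) / 4) • Matrix.of (fun _ _ => 1) -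
        (((q : ℝ) ^ 2 - q + 2) / 2) • (taylorGraph K q).adjMatrix ℝ +
        (((q : ℝ) - 1) * (q ^ 2 + 1) / 4) • 1 := by
  have hM : Matrix.of (fun u v : UnitalPoint K q =>
      ((1 + taylorSign q * quadraticChar K (hform u v) : ℤ) : ℝ)) =
      (2 : ℝ) • (taylorGraph K q).adjMatrix ℝ + 1 := by
    ext u v
    have h : ((2 * (if (taylorGraph K q).Adj u v then 1 else 0) : ℤ) : ℝ) = _ :=
      congrArg Int.cast (two_mul_adj_taylorGraph hK hq u v)
    push_cast at h
    simp only [Matrix.of_apply, Matrix.add_apply, Matrix.smul_apply, Matrix.one_apply,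
      SimpleGraph.adjMatrix_apply, smul_eq_mul]
    push_cast
    linear_combination -h
  have hMM : Matrix.of (fun u v : UnitalPoint K q =>
      ((1 + taylorSign q * quadraticChar K (hform u v) : ℤ) : ℝ)) *
      Matrix.of (fun u v : UnitalPoint K q =>
      ((1 + taylorSign q * quadraticChar K (hform u v) : ℤ) : ℝ)) =
      ((q : ℝ) ^ 3 - q ^ 2 + q - 1) • Matrix.of (fun _ _ => 1) - ((q : ℝ) ^ 2 - q) •
        Matrix.of (fun u v : UnitalPoint K q =>
          ((1 + taylorSign q * quadraticChar K (hform u v) : ℤ) : ℝ)) + ((q : ℝ) ^ 3) • 1 := by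
    ext u v
    rw [Matrix.mul_apply]
    simp only [Matrix.of_apply, Matrix.add_apply, Matrix.sub_apply, Matrix.smul_apply,
      Matrix.one_apply, smul_eq_mul]
    have h := congrArg (Int.cast : ℤ → ℝ) (sum_one_add_quadraticChar_mul hK hq u v)
    push_cast at h ⊢
    linear_combination h
  rw [hM] at hMM
  have h4 : ((2 : ℝ) • (taylorGraph K q).adjMatrix ℝ + 1) * ((2 : ℝ) • (taylorGraph K q).adjMatrix ℝ + 1) =
      (4 : ℝ) • ((taylorGraph K q).adjMatrix ℝ * (taylorGraph K q).adjMatrix ℝ) +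
        (4 : ℝ) • (taylorGraph K q).adjMatrix ℝ + 1 := by
    simp only [add_mul, mul_add, smul_mul_assoc, mul_smul_comm, mul_one, one_mul]
    module
  rw [h4] at hMM
  ext u v
  have := congrFun (congrFun hMM u) v
  simp only [Matrix.of_apply, Matrix.add_apply, Matrix.sub_apply, Matrix.smul_apply,
    smul_eq_mul] at this ⊢
  linear_combination this / 4

open Classical in
theorem card_commonNeighbors_eq_mul_self {V : Type*} [Fintype V] (G : SimpleGraph V) (u v : V) :
    (Fintype.card (G.commonNeighbors u v) : ℝ) = (G.adjMatrix ℝ * G.adjMatrix ℝ) u v := by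
  rw [SimpleGraph.adjMatrix_mul_apply]
  simp only [SimpleGraph.adjMatrix_apply, Finset.sum_boole]
  rw [← Set.toFinset_card]
  congr 2
  ext w
  simp [SimpleGraph.mem_commonNeighbors, G.adj_comm]

open Classical in
theorem isSRGWith_taylorGraph (hK : Fintype.card K = q ^ 2) (hq : Odd q) :
    ∃ l m : ℕ, (taylorGraph K q).IsSRGWith (q ^ 3) ((q - 1) * (q ^ 2 + 1) / 2) l m := by
  have h1 : ∀ u v, u ≠ v → (Fintype.card ((taylorGraph K q).commonNeighbors u v) : ℝ) =
      ((q : ℝ) - 1) * (q ^ 2 + 1) / 4 - ((q : ℝ) ^ 2 - q + 2) / 2 *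
        (if (taylorGraph K q).Adj u v then 1 else 0) := by
    intro u v huv
    rw [card_commonNeighbors_eq_mul_self, adjMatrix_taylorGraph_mul_self hK hq]
    simp [huv]
  -- The parameters are read off from any one pair, with `0` as default when no pair exists.
  have key : ∀ P : UnitalPoint K q → UnitalPoint K q → Prop,
      (∀ u v u' v', P u v → P u' v' →
        Fintype.card ((taylorGraph K q).commonNeighbors u v) =
        Fintype.card ((taylorGraph K q).commonNeighbors u' v')) →
      ∃ l, ∀ u v, P u v → Fintype.card ((taylorGraph K q).commonNeighbors u v) = l := by
    intro P h
    by_cases hP : ∃ u v, P u v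
    · obtain ⟨u, v, huv⟩ := hP
      exact ⟨_, fun u' v' h' => h _ _ _ _ h' huv⟩
    · push Not at hP
      exact ⟨0, fun u v h' => absurd h' (hP u v)⟩
  obtain ⟨l, hl⟩ := key (taylorGraph K q).Adj fun u v u' v' h h' => by
    have e := h1 u v h.ne
    have e' := h1 u' v' h'.ne
    rw [if_pos h] at e
    rw [if_pos h', ← e] at e'
    exact_mod_cast e'.symm
  obtain ⟨m, hm⟩ := key (fun u v => u ≠ v ∧ ¬ (taylorGraph K q).Adj u v)
    fun u v u' v' h h' => by
      have e := h1 u v h.1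
      have e' := h1 u' v' h'.1
      rw [if_neg h.2] at e
      rw [if_neg h'.2, ← e] at e'
      exact_mod_cast e'.symm
  exact ⟨l, m, card_unitalPoint hK hq, isRegularOfDegree_taylorGraph hK hq, hl,
    fun u v huv h => hm u v ⟨huv, h⟩⟩

theorem spec_taylorGraph (hK : Fintype.card K = q ^ 2) (hq : Odd q) :
    spec (taylorGraph K q) =
      Multiset.replicate 1 (((q : ℝ) - 1) * ((q : ℝ) ^ 2 + 1) / 2) +
      Multiset.replicate ((q - 1) * (q ^ 2 + 1)) (((q : ℝ) - 1) / 2) +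
      Multiset.replicate (q * (q - 1)) (-((q : ℝ) ^ 2 + 1) / 2) := by
  classical
  have h3 : (3 : ℝ) ≤ q := by exact_mod_cast three_le_of_card hK hq
  have hreg := isRegularOfDegree_taylorGraph hK hq
  have hk : (((q - 1) * (q ^ 2 + 1) / 2 : ℕ) : ℝ) = ((q : ℝ) - 1) * ((q : ℝ) ^ 2 + 1) / 2 := by
    have h := two_mul_degree_taylorGraph hK hq (unitalOrigin hq)
    rw [hreg.degree_eq] at h
    have h' : 2 * (((q - 1) * (q ^ 2 + 1) / 2 : ℕ) : ℝ) = ((q : ℝ) - 1) * ((q : ℝ) ^ 2 + 1) := by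
      have h' := congrArg (Int.cast : ℤ → ℝ) h
      simpa only [Int.cast_mul, Int.cast_natCast, Int.cast_sub, Int.cast_add, Int.cast_pow,
        Int.cast_one, Int.cast_ofNat] using h'
    linear_combination h' / 2
  have hquad : ((taylorGraph K q).adjMatrix ℝ - algebraMap ℝ _ (((q : ℝ) - 1) / 2)) *
      ((taylorGraph K q).adjMatrix ℝ - algebraMap ℝ _ (-((q : ℝ) ^ 2 + 1) / 2)) =
      (((q : ℝ) - 1) * (q ^ 2 + 1) / 4) • Matrix.of (fun _ _ => 1) := by
    have h := adjMatrix_taylorGraph_mul_self hK hq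
    simp only [Algebra.algebraMap_eq_smul_one, sub_mul, mul_sub, h, smul_mul_assoc, one_mul,
      mul_smul_comm, mul_one]
    module
  have hcubic : ((taylorGraph K q).adjMatrix ℝ -
      algebraMap ℝ _ (((q : ℝ) - 1) * ((q : ℝ) ^ 2 + 1) / 2)) *
      (((taylorGraph K q).adjMatrix ℝ - algebraMap ℝ _ (((q : ℝ) - 1) / 2)) *
      ((taylorGraph K q).adjMatrix ℝ - algebraMap ℝ _ (-((q : ℝ) ^ 2 + 1) / 2))) = 0 := by
    -- Regularity gives `A J = k J`, so `A - k` kills the remaining multiple of `J`.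
    rw [hquad, mul_smul_comm, ← hk, sub_mul (SimpleGraph.adjMatrix ℝ _),
      Algebra.algebraMap_eq_smul_one, smul_mul_assoc, one_mul]
    convert smul_zero (((q : ℝ) - 1) * (q ^ 2 + 1) / 4)
    ext u v
    simp [hreg.degree_eq]
  obtain ⟨x, y, z, hs, e0, e1, e2⟩ := exists_spec_eq_of_cubic (taylorGraph K q)
    (a := ((q : ℝ) - 1) * ((q : ℝ) ^ 2 + 1) / 2) (b := ((q : ℝ) - 1) / 2)
    (c := -((q : ℝ) ^ 2 + 1) / 2) (by nlinarith) (by nlinarith) (by nlinarith) hreg hcubic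
  rw [hk] at e2
  rw [card_unitalPoint hK hq] at e0 e2
  push_cast at e0 e2
  have hx : (x : ℝ) = 1 := by
    have : (q : ℝ) ^ 3 * (((q : ℝ) - 1) * (q ^ 2 + 1)) ≠ 0 := by
      have : (0 : ℝ) < q - 1 := by linarith
      positivity
    apply mul_left_cancel₀ this
    -- The coefficients are those of `4 (λ - b)(λ - c)`, which eliminates `y` and `z`.
    linear_combination 4 * e2 + (2 * (q : ℝ) ^ 2 - 2 * q + 4) * e1 -
      (q - 1) * (q ^ 2 + 1) * e0
  rw [hx] at e0 e1
  have hy : (y : ℝ) = (q - 1) * (q ^ 2 + 1) := by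
    have : (q : ℝ) * (q + 1) ≠ 0 := by positivity
    apply mul_left_cancel₀ this
    -- Likewise `2 (λ - c)` eliminates `z`, and `2 (b - c) = q (q + 1)`.
    linear_combination 2 * e1 + (q ^ 2 + 1) * e0
  have hz : (z : ℝ) = q * (q - 1) := by linear_combination e0 - hy
  have hq1 : ((q - 1 : ℕ) : ℝ) = q - 1 := by rw [Nat.cast_sub hq.pos, Nat.cast_one]
  rw [hs, show x = 1 by exact_mod_cast hx, show y = (q - 1) * (q ^ 2 + 1) by
    rw [← hq1] at hy; exact_mod_cast hy, show z = q * (q - 1) by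
    rw [← hq1] at hz; exact_mod_cast hz]

theorem sqSpread_taylorGraph (hK : Fintype.card K = q ^ 2) (hq : Odd q) :
    sqSpread (taylorGraph K q) =
      -(q : ℝ) ^ 4 / 2 + (q : ℝ) ^ 3 / 2 - (q : ℝ) ^ 2 / 2 + (q : ℝ) / 2 := by
  have h3 : (3 : ℝ) ≤ q := by exact_mod_cast three_le_of_card hK hq
  have hq0 : (0 : ℝ) ≤ q - 1 := by linarith
  have hq1 : ((q - 1 : ℕ) : ℝ) = q - 1 := by rw [Nat.cast_sub hq.pos, Nat.cast_one]
  rw [sqSpread_eq_sum, spec_taylorGraph hK hq]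
  simp only [Multiset.map_add, Multiset.sum_add, Multiset.map_replicate, Multiset.sum_replicate,
    nsmul_eq_mul]
  rw [abs_of_nonneg (by positivity : 0 ≤ ((q : ℝ) - 1) * ((q : ℝ) ^ 2 + 1) / 2),
    abs_of_nonneg (by positivity : 0 ≤ ((q : ℝ) - 1) / 2),
    abs_of_nonpos (by nlinarith : -((q : ℝ) ^ 2 + 1) / 2 ≤ 0)]
  push_cast [hq1]
  ring

/-- The lower-order part `(q³ - q² + q)/2` lies between `0` and `q⁴/4` once `q ≥ 3`. -/
theorem sqSpread_taylorGraph_bounds (hK : Fintype.card K = q ^ 2) (hq : Odd q) :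
    -(1 / 2 * (q : ℝ) ^ 4) ≤ sqSpread (taylorGraph K q) ∧
      sqSpread (taylorGraph K q) ≤ -(1 / 4 * (q : ℝ) ^ 4) := by
  have h3 : (3 : ℝ) ≤ q := by exact_mod_cast three_le_of_card hK hq
  rw [sqSpread_taylorGraph hK hq]
  constructor
  · nlinarith [mul_nonneg (by positivity : (0 : ℝ) ≤ q ^ 2) (sub_nonneg.2 h3)]
  · nlinarith [mul_nonneg (by positivity : (0 : ℝ) ≤ q ^ 3) (sub_nonneg.2 h3),
      mul_nonneg (by positivity : (0 : ℝ) ≤ q) (sub_nonneg.2 h3)]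

theorem sqSpread_blowup_taylorGraph_bounds (hK : Fintype.card K = q ^ 2) (hq : Odd q) (a : ℕ) :
    -(1 / 2 * (q : ℝ) ^ (4 + 2 * a)) ≤ sqSpread (blowup (taylorGraph K q) (q ^ a)) ∧
      sqSpread (blowup (taylorGraph K q) (q ^ a)) ≤ -(1 / 4 * (q : ℝ) ^ (4 + 2 * a)) := by
  obtain ⟨h1, h2⟩ := sqSpread_taylorGraph_bounds hK hq
  have h0 : (0 : ℝ) ≤ (q : ℝ) ^ (2 * a) := by positivity
  rw [sqSpread_blowup _ (pow_pos hq.pos a), pow_add]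
  have e : ((q ^ a : ℕ) : ℝ) ^ 2 = (q : ℝ) ^ (2 * a) := by push_cast; rw [← pow_mul, mul_comm]
  rw [e]
  constructor <;> nlinarith [mul_le_mul_of_nonneg_left h1 h0, mul_le_mul_of_nonneg_left h2 h0]

theorem natCast_pow_rpow (q a : ℕ) :
    ((q ^ (3 + a) : ℕ) : ℝ) ^ (2 - 2 / (3 + (a : ℝ))) = (q : ℝ) ^ (4 + 2 * a) := by
  rw [Nat.cast_pow, ← Real.rpow_natCast, ← Real.rpow_mul (Nat.cast_nonneg q),
    ← Real.rpow_natCast]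
  congr 1
  push_cast
  have : (3 : ℝ) + a ≠ 0 := by positivity
  field_simp
  ring

theorem card_blowup_unitalPoint (hK : Fintype.card K = q ^ 2) (hq : Odd q) (a : ℕ) :
    Fintype.card (UnitalPoint K q × Fin (q ^ a)) = q ^ (3 + a) := by
  rw [Fintype.card_prod, card_unitalPoint hK hq, Fintype.card_fin, pow_add]

theorem sqSpread_blowup_taylorGraph_le (hK : Fintype.card K = q ^ 2) (hq : Odd q) {a : ℕ} {ε : ℝ}
    (h : 2 / (3 + (a : ℝ)) ≤ ε) : sqSpread (blowup (taylorGraph K q) (q ^ a)) ≤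
      -(1 / 4 * ((q ^ (3 + a) : ℕ) : ℝ) ^ (2 - ε)) := by
  refine (sqSpread_blowup_taylorGraph_bounds hK hq a).2.trans ?_
  rw [← natCast_pow_rpow]
  have h1 : (1 : ℝ) ≤ ((q ^ (3 + a) : ℕ) : ℝ) := by exact_mod_cast Nat.one_le_pow _ _ hq.pos
  have := Real.rpow_le_rpow_of_exponent_le h1 (by linarith : 2 - ε ≤ 2 - 2 / (3 + (a : ℝ)))
  linarith

theorem exists_two_div_le {ε : ℝ} (hε : 0 < ε) : ∃ a : ℕ, 0 < a ∧ 2 / (3 + (a : ℝ)) ≤ ε := by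
  obtain ⟨a, ha⟩ := exists_nat_gt (2 / ε)
  refine ⟨a, ?_, ?_⟩
  · have : (0 : ℝ) < a := (by positivity : 0 < 2 / ε).trans ha
    exact_mod_cast this
  · rw [div_lt_iff₀ hε] at ha
    rw [div_le_iff₀ (by positivity)]
    nlinarith

theorem exists_graph_sqSpread_le {ε : ℝ} (hε : 0 < ε) (N : ℕ) : ∃ n : ℕ, N ≤ n ∧
    ∃ G : SimpleGraph (Fin n), sqSpread G ≤ -(1 / 4 * (n : ℝ) ^ (2 - ε)) := by
  obtain ⟨a, -, ha⟩ := exists_two_div_le hε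
  -- Prime `q` suffices; the bound `3` forces `p` to be odd and `N` makes the order large.
  obtain ⟨p, hp, hpr⟩ := Nat.exists_infinite_primes (max N 3)
  have hodd : Odd p := hpr.odd_of_ne_two (by omega)
  have : Fact p.Prime := ⟨hpr⟩
  let _ := Fintype.ofFinite (GaloisField p 2)
  have hK : Fintype.card (GaloisField p 2) = p ^ 2 := by
    rw [← Nat.card_eq_fintype_card, GaloisField.card p 2 two_ne_zero]
  let e := Fintype.equivFinOfCardEq (card_blowup_unitalPoint hK hodd a)
  refine ⟨p ^ (3 + a), ?_, (blowup (taylorGraph (GaloisField p 2) p) (p ^ a)).map e, ?_⟩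
  · exact ((le_max_left _ _).trans hp).trans (Nat.le_self_pow (by omega) p)
  · rw [← sqSpread_eq_of_spec_eq (spec_eq_of_iso (SimpleGraph.Iso.map e _))]
    exact sqSpread_blowup_taylorGraph_le hK hodd ha

end Taylor
end SquareEnergy

open SquareEnergy in
open Classical in
theorem mainTheorem4 :
    -- for every `ε > 0` there are arbitrarily large graphs with `s⁺ - s⁻ = -Ω(n^{2-ε})`
    (∀ ε : ℝ, 0 < ε → ∃ c : ℝ, 0 < c ∧ ∀ N : ℕ, ∃ n : ℕ, N ≤ n ∧
      ∃ G : SimpleGraph (Fin n), sqSpread G ≤ -(c * (n : ℝ) ^ (2 - ε))) ∧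
    -- blowups of Taylor's graphs by a suitable power of `q` are such a family
    (∀ ε : ℝ, 0 < ε → ∃ a : ℕ, 0 < a ∧ ∃ c : ℝ, 0 < c ∧
      ∀ q : ℕ, IsPrimePow q → Odd q →
      ∀ (K : Type*) [Field K] [Fintype K], Fintype.card K = q ^ 2 →
        Fintype.card (UnitalPoint K q × Fin (q ^ a)) = q ^ (3 + a) ∧
        sqSpread (blowup (taylorGraph K q) (q ^ a)) ≤
          -(c * ((q ^ (3 + a) : ℕ) : ℝ) ^ (2 - ε))) ∧
    -- Taylor's graphs: strongly regular on `q³` vertices, spectrum `k¹ r^f s^g`, squared spread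
    (∀ q : ℕ, IsPrimePow q → Odd q →
      ∀ (K : Type*) [Field K] [Fintype K], Fintype.card K = q ^ 2 →
        (∃ l m : ℕ, (taylorGraph K q).IsSRGWith (q ^ 3) ((q - 1) * (q ^ 2 + 1) / 2) l m) ∧
        spec (taylorGraph K q) =
          Multiset.replicate 1 (((q : ℝ) - 1) * ((q : ℝ) ^ 2 + 1) / 2) +
          Multiset.replicate ((q - 1) * (q ^ 2 + 1)) (((q : ℝ) - 1) / 2) +
          Multiset.replicate (q * (q - 1)) (-((q : ℝ) ^ 2 + 1) / 2) ∧
        sqSpread (taylorGraph K q) =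
          -(q : ℝ) ^ 4 / 2 + (q : ℝ) ^ 3 / 2 - (q : ℝ) ^ 2 / 2 + (q : ℝ) / 2) ∧
    -- this squared spread is `-Θ(n^{4/3})`, `n = q³`
    (∃ c C : ℝ, 0 < c ∧ 0 < C ∧ ∀ q : ℕ, IsPrimePow q → Odd q →
      ∀ (K : Type*) [Field K] [Fintype K], Fintype.card K = q ^ 2 →
        -(C * ((q ^ 3 : ℕ) : ℝ) ^ (4 / 3 : ℝ)) ≤ sqSpread (taylorGraph K q) ∧
        sqSpread (taylorGraph K q) ≤ -(c * ((q ^ 3 : ℕ) : ℝ) ^ (4 / 3 : ℝ))) ∧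
    -- the squared spread of the `q^a`-blowup is `-Θ(n^{2-2/(3+a)})`, `n = q^{3+a}`
    (∀ a : ℕ, 0 < a → ∃ c C : ℝ, 0 < c ∧ 0 < C ∧ ∀ q : ℕ, IsPrimePow q → Odd q →
      ∀ (K : Type*) [Field K] [Fintype K], Fintype.card K = q ^ 2 →
        -(C * ((q ^ (3 + a) : ℕ) : ℝ) ^ (2 - 2 / (3 + (a : ℝ)))) ≤
          sqSpread (blowup (taylorGraph K q) (q ^ a)) ∧
        sqSpread (blowup (taylorGraph K q) (q ^ a)) ≤
          -(c * ((q ^ (3 + a) : ℕ) : ℝ) ^ (2 - 2 / (3 + (a : ℝ))))) ∧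
    -- a blowup multiplies the eigenvalues by `t` and adds `(t - 1)|V|` zeros
    (∀ (V : Type*) [Fintype V] (G : SimpleGraph V) (t : ℕ), 0 < t →
      spec (blowup G t) =
        (spec G).map (fun x => (t : ℝ) * x) +
          Multiset.replicate ((t - 1) * Fintype.card V) 0) := by
  refine ⟨fun ε hε => ⟨1 / 4, by norm_num, exists_graph_sqSpread_le hε⟩, fun ε hε => ?_,
    fun q _ hq K _ _ hK => ⟨isSRGWith_taylorGraph hK hq, spec_taylorGraph hK hq,
      sqSpread_taylorGraph hK hq⟩,
    ⟨1 / 4, 1 / 2, by norm_num, by norm_num, fun q _ hq K _ _ hK => ?_⟩,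
    fun a _ => ⟨1 / 4, 1 / 2, by norm_num, by norm_num, fun q _ hq K _ _ hK => ?_⟩,
    fun V _ G t ht => spec_blowup G ht⟩
  · obtain ⟨a, ha, h⟩ := exists_two_div_le hε
    exact ⟨a, ha, 1 / 4, by norm_num, fun q _ hq K _ _ hK =>
      ⟨card_blowup_unitalPoint hK hq a, sqSpread_blowup_taylorGraph_le hK hq h⟩⟩
  -- With `a = 0` the exponent `2 - 2/(3+a)` is `4/3`.
  · have h := natCast_pow_rpow q 0
    norm_num at h
    rw [Nat.cast_pow, h]
    exact sqSpread_taylorGraph_bounds hK hq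
  · rw [natCast_pow_rpow]
    exact sqSpread_blowup_taylorGraph_bounds hK hq a
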